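/- Let $T>0$, $\omega=2\pi/T$, and let $J:\mathbb R\to\mathbb R^{n\times n}$ be $T$-periodic with Fourier coefficients $J_k=\frac1T\int_0^T J(s)e^{-ik\omega s}\,ds\in\mathbb C^{n\times n}$, $k\in\mathbb Z$, whose Fourier series converges pointwise to $J$: $J(t)=\sum_{k\in\mathbb Z}J_ke^{ik\omega t}$ for all $t$. Let $\Phi$ be the fundamental solution matrix, i.e. the solution of $\dot\Phi(t)=J(t)\Phi(t)$ on $\mathbb R$ with $\Phi(0)=I$. For $N\in\mathbb N=\{0,1,2,\dots\}$ let $H\in\mathbb C^{n(2N+1)\times n(2N+1)}$ be the truncated Hill matrix, whose $n\times n$ block in block row $r$ and block column $c$ ($r,c\in\{-N,\dots,N\}$) is $J_{r-c}$ for $r\ne c$ and $J_0-ir\omega I$ for $r=c$; let $C=(0\ \cdots\ 0\ I\ 0\ \cdots\ 0)$ be the $n\times n(2N+1)$ matrix that extracts the central block, and $W=(I\ \cdots\ I)^{\mathsf T}$ the stack of $2N+1$ identity matrices of size $n$. Let $\|\cdot\|$ be the matrix norm induced by a vector $p$-norm on $\mathbb C^n$, $1\le p\le\infty$, and suppose that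 there are constants $a>0$ and $b>\ln 2$ with $\|J_k\|\le a\,e^{-b|k|}$ for all $k\in\mathbb Z$. Then: (i) for every $N\in\mathbb N$ and every $t\in\mathbb R$, $$\|\Phi(t)-Ce^{Ht}W\|\le(2e^{-b})^N\left(e^{|4at|}-1\right);$$ (ii) $0<2e^{-b}<1$, so that this bound decays exponentially in $N$, and $\|\Phi(t)-Ce^{Ht}W\|\to0$ as $N\to\infty$, for every $t\in\mathbb R$; (iii) for every $E_{\mathrm{des}}>0$ and every $t\in\mathbb R$, the accuracy $\|\Phi(t)-Ce^{Ht}W\|\le E_{\mathrm{des}}$ holds for every $N\in\mathbb N$ with $$N\ge N^*=\frac{|4at|+\ln\left(1-e^{-|4at|}\right)-\ln E_{\mathrm{des}}}{b-\ln2},$$ where for $t=0$ one reads $N^*=-\infty$, i.e. every $N$ is allowed. -/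

import Mathlib

open Filter Topology
open scoped ENNReal

noncomputable section

namespace KoopmanHill

/-- The matrix norm induced by the vector `p`-norm on `ℂⁿ`. -/
def pNorm (p : ℝ≥0∞) [Fact (1 ≤ p)] {n : ℕ} (A : Matrix (Fin n) (Fin n) ℂ) : ℝ :=
  ‖LinearMap.toContinuousLinearMap (Matrix.toLpLin p p A)‖

/-- The `k`-th (complex, matrix-valued) Fourier coefficient of the `T`-periodic real matrix
function `J`, i.e. `(1/T) ∫₀ᵀ J(s) e^{-ikωs} ds` entry by entry, with `ω = 2π/T`. -/
def coeff {n : ℕ} {T : ℝ} (hT : 0 < T) (J : ℝ → Matrix (Fin n) (Fin n) ℝ) (k : ℤ) :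
    Matrix (Fin n) (Fin n) ℂ :=
  Matrix.of fun i j => fourierCoeffOn hT (fun s => ((J s i j : ℝ) : ℂ)) k

/-- The Fourier series `∑ₖ Jₖ e^{ikωt}` of `J` (symmetric partial sums) converges to `J t` at
every `t`. -/
def HasPointwiseFourierSeries {n : ℕ} {T : ℝ} (hT : 0 < T)
    (J : ℝ → Matrix (Fin n) (Fin n) ℝ) : Prop :=
  ∀ t : ℝ, Tendsto
    (fun K : ℕ => ∑ k ∈ Finset.Icc (-(K : ℤ)) (K : ℤ),
      Complex.exp (Complex.I * (k : ℂ) * ((2 * Real.pi / T : ℝ) : ℂ) * (t : ℂ)) • coeff hT J k)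
    atTop (𝓝 ((J t).map (fun x : ℝ => (x : ℂ))))

/-- `Φ` solves the matrix initial value problem `Φ' = J(t) Φ`, `Φ(0) = I`. -/
def IsFundamentalSolution {n : ℕ} (J Φ : ℝ → Matrix (Fin n) (Fin n) ℝ) : Prop :=
  Φ 0 = 1 ∧ ∀ t : ℝ, HasDerivAt Φ (J t * Φ t) t

/-- The block indices `-N, …, N`. -/
abbrev Idx (N : ℕ) : Type := ↥(Finset.Icc (-(N : ℤ)) (N : ℤ))

/-- The truncated Hill matrix: `(2N+1) × (2N+1)` blocks of size `n × n`, the block in block row `r`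
and block column `c` (`-N ≤ r, c ≤ N`) being `J_{r-c}`, minus `i r ω I` on the diagonal `r = c`. -/
def hill {n : ℕ} {T : ℝ} (hT : 0 < T) (J : ℝ → Matrix (Fin n) (Fin n) ℝ) (N : ℕ) :
    Matrix (Idx N × Fin n) (Idx N × Fin n) ℂ :=
  Matrix.of fun r c =>
    coeff hT J ((r.1 : ℤ) - (c.1 : ℤ)) r.2 c.2 -
      (if r = c then Complex.I * ((r.1 : ℤ) : ℂ) * ((2 * Real.pi / T : ℝ) : ℂ) else 0)

/-- `C = (0 … 0 I 0 … 0)`, which extracts the central block. -/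
def matC (n N : ℕ) : Matrix (Fin n) (Idx N × Fin n) ℂ :=
  Matrix.of fun i c => if (c.1 : ℤ) = 0 ∧ i = c.2 then 1 else 0

/-- `W = (I … I)ᵀ`, the vertical stack of `2N+1` identity matrices. -/
def matW (n N : ℕ) : Matrix (Idx N × Fin n) (Fin n) ℂ :=
  Matrix.of fun r j => if r.2 = j then 1 else 0

/-- The direct Koopman-Hill projection `C e^{Ht} W` of truncation order `N`. -/
def projection {n : ℕ} {T : ℝ} (hT : 0 < T) (J : ℝ → Matrix (Fin n) (Fin n) ℝ) (N : ℕ) (t : ℝ) :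
    Matrix (Fin n) (Fin n) ℂ :=
  matC n N * NormedSpace.exp ((t : ℂ) • hill hT J N) * matW n N

/-- The approximation error `‖Φ(t) - C e^{Ht} W‖` in the induced `p`-norm. -/
def error (p : ℝ≥0∞) [Fact (1 ≤ p)] {n : ℕ} {T : ℝ} (hT : 0 < T)
    (J Φ : ℝ → Matrix (Fin n) (Fin n) ℝ) (N : ℕ) (t : ℝ) : ℝ :=
  pNorm p ((Φ t).map (fun x : ℝ => (x : ℂ)) - projection hT J N t)

end KoopmanHill

end

namespace KoopmanHill

/-! Demodulating block row `r` of `e^{Ht} W` by `e^{irωt}` turns the Hill system into `Y_r' = ∑_c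
A_{r-c}(t) Y_c`, `|c| ≤ N`, with `A_k(t) = J_k e^{ikωt}` and `Y_r(0) = I`. The same system over all
`c ∈ ℤ` is solved by the constant family `Φ`, because `∑_k A_k = J`. With `Y_c = 0` for `|c| > N`,
the errors `e_c = Φ - Y_c` therefore satisfy `e_r' = ∑_{c ∈ ℤ} A_{r-c} e_c` for `|r| ≤ N`.

Put `q = e^{-b}` and weight the errors by `w_c = (2q)^(N-|c|)`. The weights absorb a factor
`2^{-|r-c|}` of the kernel (`pow_natAbs_mul_weight_le`), and `∑_k 2^{-|k|} = 3` gives the rate `3a`.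
A fencing argument with the strictly larger rate `4a` bounds `|e_r|` by `w_r (e^{4a|t|} - 1)`
(`norm_sub_truncated_le`); the central row, `w_0 = (2q)^N`, is the claim. -/

lemma hasSum_half_pow_natAbs : HasSum (fun k : ℤ => (1 / 2 : ℝ) ^ k.natAbs) 3 := by
  have h : HasSum (fun k : ℕ => (1 / 2 : ℝ) ^ k) 2 := hasSum_geometric_two
  have := HasSum.of_nat_of_neg (f := fun k : ℤ => (1 / 2 : ℝ) ^ k.natAbs)
    (by simpa using h) (by simpa using h)
  norm_num at this ⊢
  exact this

/-! ### Fencing and the weighted comparison of the full and truncated systems -/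

/-- Two-sided fencing: a differential inequality in `|t|` that is strict on contact keeps `‖f t‖`
below the barrier `B |t|` on the whole line. -/
lemma norm_le_of_norm_deriv_lt_barrier {F : Type*} [NormedAddCommGroup F] [NormedSpace ℝ F]
    {f f' : ℝ → F} {B B' : ℝ → ℝ} (hf : ∀ t, HasDerivAt f (f' t) t) (h0 : ‖f 0‖ ≤ B 0)
    (hB : ∀ t, HasDerivAt B (B' t) t)
    (bound : ∀ t, ‖f t‖ = B |t| → ‖f' t‖ < B' |t|) (t : ℝ) : ‖f t‖ ≤ B |t| := by
  have key : ∀ g g' : ℝ → F, (∀ t, HasDerivAt g (g' t) t) → ‖g 0‖ ≤ B 0 →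
      (∀ t, ‖g t‖ = B |t| → ‖g' t‖ < B' |t|) → ∀ t, 0 ≤ t → ‖g t‖ ≤ B t := by
    intro g g' hg hg0 hb t ht
    refine image_norm_le_of_norm_deriv_right_lt_deriv_boundary (a := 0) (b := t)
      (fun x _ => (hg x).continuousAt.continuousWithinAt)
      (fun x _ => (hg x).hasDerivWithinAt) hg0 hB (fun x hx h => ?_) ⟨ht, le_rfl⟩
    have := hb x
    rw [abs_of_nonneg hx.1] at this
    exact this h
  rcases le_total 0 t with ht | ht
  · rw [abs_of_nonneg ht]
    exact key f f' hf h0 bound t ht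
  · rw [abs_of_nonpos ht]
    -- Negative times reduce to positive ones by time reversal.
    have := key (fun x => f (-x)) (fun x => -f' (-x))
      (fun x => by simpa [Function.comp_def] using (hf (-x)).scomp x (hasDerivAt_neg x)) (by simpa using h0)
      (fun x hx => by simpa using bound (-x) (by simpa using hx)) (-t) (by linarith)
    simpa using this

/-- Exponential growth bound for a linear differential equation with `‖J t‖ ≤ 3a`. -/
lemma norm_fundamental_le {R : Type*} [NormedRing R] [NormedAlgebra ℝ R] {J φ : ℝ → R} {a : ℝ}
    (ha : 0 < a) (hJ : ∀ t, ‖J t‖ ≤ 3 * a) (hφ : ∀ t, HasDerivAt φ (J t * φ t) t)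
    (h0 : ‖φ 0‖ ≤ 1) (t : ℝ) : ‖φ t‖ ≤ Real.exp (4 * a * |t|) := by
  refine norm_le_of_norm_deriv_lt_barrier (B := fun t => Real.exp (4 * a * t))
    (B' := fun t => Real.exp (4 * a * t) * (4 * a)) hφ (by simpa using h0) (fun t => ?_)
    (fun t ht => ?_) t
  · simpa using ((hasDerivAt_id t).const_mul (4 * a)).exp
  · calc ‖J t * φ t‖ ≤ ‖J t‖ * ‖φ t‖ := norm_mul_le _ _
      _ ≤ 3 * a * Real.exp (4 * a * |t|) := by rw [ht]; gcongr; exact hJ t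
      _ < Real.exp (4 * a * |t|) * (4 * a) := by nlinarith [Real.exp_pos (4 * a * |t|)]

/-- Split `q^d = (1/2)^d (2q)^d` with `d = |r - c|`. Since `2q < 1`, the rest is the triangle
inequality `|c| ≤ |r| + d` in the exponents. -/
lemma pow_natAbs_mul_weight_le {q : ℝ} (hq : 0 < q) (hq2 : 2 * q < 1) (N : ℕ) (r c : ℤ) :
    q ^ (r - c).natAbs * (2 * q) ^ ((N : ℤ) - c.natAbs) ≤
      (1 / 2) ^ (r - c).natAbs * (2 * q) ^ ((N : ℤ) - r.natAbs) := by
  have hs : (0 : ℝ) < 2 * q := by positivity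
  have e : q ^ (r - c).natAbs = (1 / 2) ^ (r - c).natAbs * (2 * q) ^ (((r - c).natAbs : ℕ) : ℤ) := by
    rw [zpow_natCast, ← mul_pow]; congr 1; ring
  rw [e, mul_assoc, ← zpow_add₀ hs.ne']
  gcongr ?_ * ?_
  exact zpow_le_zpow_right_of_le_one₀ hs hq2.le (by omega)

/-- Truncating a two-sided convolution system with exponentially decaying kernel: comparison of
its constant solution `φ` with the solution `Y` of the truncated system. -/
lemma norm_sub_truncated_le {R : Type*} [NormedRing R] [NormedAlgebra ℝ R] {a q : ℝ}
    (ha : 0 < a) (hq : 0 < q) (hq2 : 2 * q < 1) {A : ℤ → ℝ → R} {J φ : ℝ → R}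
    (hA : ∀ k t, ‖A k t‖ ≤ a * q ^ k.natAbs) (hJ : ∀ t, HasSum (fun k => A k t) (J t))
    (hφ : ∀ t, HasDerivAt φ (J t * φ t) t) (h0 : ‖φ 0‖ ≤ 1) {N : ℕ} {Y : Idx N → ℝ → R}
    (hY : ∀ r t, HasDerivAt (Y r) (∑ c : Idx N, A (r.1 - c.1) t * Y c t) t)
    (hY0 : ∀ r, Y r 0 = φ 0) (r : Idx N) (t : ℝ) :
    ‖φ t - Y r t‖ ≤ (2 * q) ^ ((N : ℤ) - (r : ℤ).natAbs) * (Real.exp (4 * a * |t|) - 1) := by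
  have hs : (0 : ℝ) < 2 * q := by positivity
  have hJn : ∀ t, ‖J t‖ ≤ 3 * a := fun t => by
    rw [mul_comm]
    refine (hJ t).norm_le_of_bounded (hasSum_half_pow_natAbs.mul_left a) fun k => (hA k t).trans ?_
    gcongr
    linarith
  have hφn := norm_fundamental_le ha hJn hφ h0
  set w : ℤ → ℝ := fun c => (2 * q) ^ ((N : ℤ) - c.natAbs) with hw
  have wpos : ∀ c, 0 < w c := fun c => zpow_pos hs _
  have main := norm_le_of_norm_deriv_lt_barrier
    (f := fun t (r : Idx N) => (w r)⁻¹ • (φ t - Y r t))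
    (f' := fun t (r : Idx N) =>
      (w r)⁻¹ • (J t * φ t - ∑ c : Idx N, A (r.1 - c.1) t * Y c t))
    (B := fun t => Real.exp (4 * a * t) - 1)
    (B' := fun t => Real.exp (4 * a * t) * (4 * a))
    (fun t => hasDerivAt_pi.2 fun r => ((hφ t).fun_sub (hY r t)).fun_const_smul _)
    (by simp only [hY0, sub_self, smul_zero]; simp [← Pi.zero_def])
    (fun t => by simpa using (((hasDerivAt_id t).const_mul (4 * a)).exp).sub_const 1)
    (fun t ht => by
      have hlt : 3 * a * Real.exp (4 * a * |t|) < Real.exp (4 * a * |t|) * (4 * a) := by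
        nlinarith [Real.exp_pos (4 * a * |t|)]
      refine lt_of_le_of_lt ((pi_norm_le_iff_of_nonneg (by positivity)).2 fun r => ?_) hlt
      set X := Real.exp (4 * a * |t|) with hX
      -- Extending the error by `φ` outside the window makes the truncated sum a full convolution.
      let e : ℤ → R := fun c => if h : c ∈ Finset.Icc (-(N : ℤ)) N then φ t - Y ⟨c, h⟩ t else φ t
      have he : ∀ c, ‖e c‖ ≤ w c * X := fun c => by
        by_cases h : c ∈ Finset.Icc (-(N : ℤ)) N
        · have h1 := (norm_le_pi_norm (fun r : Idx N => (w r)⁻¹ • (φ t - Y r t)) ⟨c, h⟩).trans_eq ht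
          rw [norm_smul, norm_inv, Real.norm_of_nonneg (wpos _).le,
            inv_mul_le_iff₀ (wpos _)] at h1
          simp only [e, dif_pos h]
          exact h1.trans (mul_le_mul_of_nonneg_left (by linarith) (wpos _).le)
        · simp only [e, dif_neg h]
          -- Outside the window the exponent `N - |c|` is negative, so the weight is at least 1 and
          -- the growth bound on `φ` suffices.
          refine (hφn t).trans (le_mul_of_one_le_left (Real.exp_pos _).le ?_)
          refine one_le_zpow_of_nonpos₀ hs hq2.le ?_
          simp only [Finset.mem_Icc] at h
          omega
      have hsum : HasSum (fun c : ℤ => A (r.1 - c) t * e c)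
          (J t * φ t - ∑ c : Idx N, A (r.1 - c.1) t * Y c t) := by
        have h1 : HasSum (fun c : ℤ => A (r.1 - c) t * φ t) (J t * φ t) :=
          (((Equiv.subLeft (r : ℤ)).hasSum_iff).2 (hJ t)).mul_right _
        have h2 : HasSum (fun c : ℤ => if h : c ∈ Finset.Icc (-(N : ℤ)) N then
            A (r.1 - c) t * Y ⟨c, h⟩ t else 0) (∑ c : Idx N, A (r.1 - c.1) t * Y c t) := by
          have h3 := hasSum_sum_of_ne_finset_zero (L := .unconditional ℤ) (s := Finset.Icc (-(N : ℤ)) N)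
            (f := fun c : ℤ => if h : c ∈ Finset.Icc (-(N : ℤ)) N then
              A (r.1 - c) t * Y ⟨c, h⟩ t else 0) (fun c hc => dif_neg hc)
          rw [← Finset.sum_coe_sort] at h3
          convert h3 using 2 with c
          rw [dif_pos c.2]
        refine (congrArg (HasSum · _) (funext fun c => ?_)).mpr (h1.sub h2)
        by_cases h : c ∈ Finset.Icc (-(N : ℤ)) N
        · simp only [e, dif_pos h, mul_sub]
        · simp only [e, dif_neg h, sub_zero]
      have hg : HasSum (fun c : ℤ => (a * w r * X) * (1 / 2 : ℝ) ^ (r.1 - c).natAbs)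
          ((a * w r * X) * 3) :=
        (((Equiv.subLeft (r : ℤ)).hasSum_iff).2 hasSum_half_pow_natAbs).mul_left _
      have hb := hsum.norm_le_of_bounded hg fun c => by
        calc ‖A (r.1 - c) t * e c‖ ≤ ‖A (r.1 - c) t‖ * ‖e c‖ := norm_mul_le _ _
          _ ≤ (a * q ^ (r.1 - c).natAbs) * (w c * X) := by
            gcongr
            exacts [hA _ _, he c]
          _ = a * X * (q ^ (r.1 - c).natAbs * w c) := by ring
          _ ≤ a * X * ((1 / 2) ^ (r.1 - c).natAbs * w r) := by
            have := pow_natAbs_mul_weight_le hq hq2 N r c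
            gcongr
          _ = _ := by ring
      rw [norm_smul, norm_inv, Real.norm_of_nonneg (wpos _).le, inv_mul_le_iff₀ (wpos _)]
      exact hb.trans_eq (by ring)) t
  have h1 := (norm_le_pi_norm _ r).trans main
  rwa [norm_smul, norm_inv, Real.norm_of_nonneg (wpos _).le, inv_mul_le_iff₀ (wpos _)] at h1

/-- `N` beyond the threshold makes `s ^ N (eˣ - 1)` at most `E`. -/
lemma pow_mul_exp_sub_one_le {b x E : ℝ} {N : ℕ} (hb : Real.log 2 < b) (hx : 0 < x) (hE : 0 < E)
    (hN : (x + Real.log (1 - Real.exp (-x)) - Real.log E) / (b - Real.log 2) ≤ N) :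
    (2 * Real.exp (-b)) ^ N * (Real.exp x - 1) ≤ E := by
  have h1 : 0 < 1 - Real.exp (-x) := by
    have := Real.exp_lt_one_iff.2 (neg_lt_zero.2 hx); linarith
  rw [div_le_iff₀ (by linarith)] at hN
  -- Factor `e^x - 1 = e^x (1 - e^{-x})`, so that both factors of the bound become exponentials.
  have e1 : Real.exp x - 1 = Real.exp (x + Real.log (1 - Real.exp (-x))) := by
    rw [Real.exp_add, Real.exp_log h1, mul_sub, ← Real.exp_add]; simp
  have e2 : (2 * Real.exp (-b)) ^ N = Real.exp (-(N * (b - Real.log 2))) := by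
    have : 2 * Real.exp (-b) = Real.exp (-(b - Real.log 2)) := by
      rw [neg_sub, sub_eq_add_neg, Real.exp_add, Real.exp_log (by norm_num)]
    rw [this, ← Real.exp_nat_mul]; ring_nf
  rw [e1, e2, ← Real.exp_add]
  calc _ ≤ Real.exp (Real.log E) := Real.exp_le_exp.2 (by linarith)
    _ = E := Real.exp_log hE

/-! ### Matrices as operators, and entrywise derivatives -/

/-- A matrix as an operator on `ℂⁿ` with the `p`-norm. -/
noncomputable def lpOp (p : ℝ≥0∞) [Fact (1 ≤ p)] (n : ℕ) : Matrix (Fin n) (Fin n) ℂ →ₗ[ℂ]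
    (WithLp p (Fin n → ℂ) →L[ℂ] WithLp p (Fin n → ℂ)) :=
  LinearMap.toContinuousLinearMap.toLinearMap ∘ₗ (Matrix.toLpLin p p).toLinearMap

variable {n : ℕ} (p : ℝ≥0∞) [Fact (1 ≤ p)]

lemma norm_lpOp (A : Matrix (Fin n) (Fin n) ℂ) : ‖lpOp p n A‖ = pNorm p A := rfl

lemma lpOp_mul (A B : Matrix (Fin n) (Fin n) ℂ) : lpOp p n (A * B) = lpOp p n A * lpOp p n B := by
  ext1 x
  simp [lpOp, Matrix.toLpLin_mul_same]

lemma lpOp_one : lpOp p n 1 = 1 := by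
  ext1 x
  simp [lpOp]

lemma continuous_lpOp : Continuous (lpOp p n) :=
  LinearMap.continuous_of_finiteDimensional _

lemma hasDerivAt_lpOp {M : ℝ → Matrix (Fin n) (Fin n) ℂ} {M' : Matrix (Fin n) (Fin n) ℂ} {t : ℝ}
    (h : ∀ i j, HasDerivAt (fun t => M t i j) (M' i j) t) :
    HasDerivAt (fun t => lpOp p n (M t)) (lpOp p n M') t := by
  have e : ∀ A : Matrix (Fin n) (Fin n) ℂ,
      lpOp p n A = ∑ i, ∑ j, A i j • lpOp p n (Matrix.single i j 1) := fun A => by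
    conv_lhs => rw [Matrix.matrix_eq_sum_single A]
    simp only [map_sum, ← map_smul, Matrix.smul_single, smul_eq_mul, mul_one]
  rw [e M', funext fun t => e (M t)]
  exact HasDerivAt.fun_sum fun i _ => HasDerivAt.fun_sum fun j _ =>
    (h i j).smul_const (lpOp p n (Matrix.single i j 1))

section MatrixDeriv

attribute [local instance] Matrix.linftyOpNormedRing Matrix.linftyOpNormedAlgebra
  Matrix.linftyOpNormedAddCommGroup Matrix.linftyOpNormedSpace

/-- Stated for single entries, so that the auxiliary matrix norm used to differentiate the
exponential does not enter the statement. -/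
lemma hasDerivAt_matrix_exp_mul_apply {ι κ : Type*} [Fintype ι] [DecidableEq ι]
    (H : Matrix ι ι ℂ) (W : Matrix ι κ ℂ) (i : ι) (j : κ) (t : ℝ) :
    HasDerivAt (fun t : ℝ => (NormedSpace.exp ((t : ℂ) • H) * W) i j)
      ((H * (NormedSpace.exp ((t : ℂ) • H) * W)) i j) t := by
  have h1 : HasDerivAt (fun z : ℂ => NormedSpace.exp (z • H))
      (H * NormedSpace.exp ((t : ℂ) • H)) (t : ℂ) := hasDerivAt_exp_smul_const' H (t : ℂ)
  let L : Matrix ι ι ℂ →L[ℂ] ℂ := LinearMap.toContinuousLinearMap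
    { toFun := fun M => (M * W) i j
      map_add' := fun M M' => by rw [Matrix.add_mul]; rfl
      map_smul' := fun c M => by rw [Matrix.smul_mul]; rfl }
  have h2 := (L.hasFDerivAt.comp_hasDerivAt (t : ℂ) h1).comp_ofReal
  rw [← Matrix.mul_assoc]
  exact h2

end MatrixDeriv

lemma hasDerivAt_matrix_apply {M : ℝ → Matrix (Fin n) (Fin n) ℝ} {M' : Matrix (Fin n) (Fin n) ℝ}
    {t : ℝ} (h : HasDerivAt M M' t) (i j : Fin n) : HasDerivAt (fun t => M t i j) (M' i j) t :=
  have h' : HasDerivAt (fun t i j => M t i j) (fun i j => M' i j) t := h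
  hasDerivAt_pi.1 (hasDerivAt_pi.1 h' i) j

/-! ### The demodulated Hill system -/

variable {T : ℝ} (hT : 0 < T) (J Φ : ℝ → Matrix (Fin n) (Fin n) ℝ)

/-- The `k`-th harmonic `Jₖ e^{ikωt}`. -/
noncomputable def harmonic (k : ℤ) (t : ℝ) : Matrix (Fin n) (Fin n) ℂ :=
  Complex.exp (Complex.I * (k : ℂ) * ((2 * Real.pi / T : ℝ) : ℂ) * (t : ℂ)) • coeff hT J k

/-- Block row `r` of `e^{Ht} W`, demodulated by `e^{irωt}`. -/
noncomputable def demodulated (N : ℕ) (r : Idx N) (t : ℝ) : Matrix (Fin n) (Fin n) ℂ :=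
  Complex.exp (Complex.I * ((r : ℤ) : ℂ) * ((2 * Real.pi / T : ℝ) : ℂ) * (t : ℂ)) •
    Matrix.of fun i j => (NormedSpace.exp ((t : ℂ) • hill hT J N) * matW n N) (r, i) j

lemma norm_exp_I_mul (k : ℤ) (x t : ℝ) :
    ‖Complex.exp (Complex.I * (k : ℂ) * (x : ℂ) * (t : ℂ))‖ = 1 := by
  rw [show Complex.I * (k : ℂ) * (x : ℂ) * (t : ℂ) = ((k * x * t : ℝ) : ℂ) * Complex.I by
    push_cast; ring]
  exact Complex.norm_exp_ofReal_mul_I _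

lemma norm_lpOp_harmonic (k : ℤ) (t : ℝ) :
    ‖lpOp p n (harmonic hT J k t)‖ = pNorm p (coeff hT J k) := by
  rw [harmonic, map_smul, norm_smul, norm_exp_I_mul, one_mul, norm_lpOp]

lemma demodulated_zero (N : ℕ) (r : Idx N) : demodulated hT J N r 0 = 1 := by
  ext i j
  simp [demodulated, matW, Matrix.one_apply]

lemma demodulated_center (N : ℕ) (t : ℝ) :
    demodulated hT J N ⟨0, by simp⟩ t = projection hT J N t := by
  ext i j
  rw [projection, Matrix.mul_assoc, Matrix.mul_apply, Finset.sum_eq_single (⟨0, by simp⟩, i)]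
  · simp [demodulated, matC]
  · rintro ⟨c, k⟩ - h
    have : ¬ ((c : ℤ) = 0 ∧ i = k) := by
      rintro ⟨hc, rfl⟩
      exact h (by simp [Prod.ext_iff, Subtype.ext_iff, hc])
    simp [matC, this]
  · simp

lemma hill_mul_apply (N : ℕ) (X : Matrix (Idx N × Fin n) (Fin n) ℂ) (r : Idx N) (i j : Fin n) :
    (hill hT J N * X) (r, i) j =
      (∑ c : Idx N, ∑ k, coeff hT J ((r : ℤ) - (c : ℤ)) i k * X (c, k) j) -
        Complex.I * ((r : ℤ) : ℂ) * ((2 * Real.pi / T : ℝ) : ℂ) * X (r, i) j := by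
  rw [Matrix.mul_apply]
  simp only [hill, Matrix.of_apply, sub_mul, Finset.sum_sub_distrib, Fintype.sum_prod_type]
  congr 1
  rw [← Fintype.sum_prod_type', Finset.sum_eq_single (r, i)]
  · simp
  · rintro ⟨c, k⟩ - h
    rw [if_neg (fun h' => h h'.symm), zero_mul]
  · simp

/-- Differentiating the phase cancels the diagonal term `-irωI` of the Hill matrix, and `e^{irωt} =
e^{i(r-c)ωt} e^{icωt}` distributes the phase over the convolution. -/
lemma hasDerivAt_demodulated (N : ℕ) (r : Idx N) (t : ℝ) (i j : Fin n) :
    HasDerivAt (fun t => demodulated hT J N r t i j)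
      ((∑ c : Idx N, harmonic hT J ((r : ℤ) - (c : ℤ)) t * demodulated hT J N c t) i j) t := by
  have h1 : HasDerivAt
      (fun t : ℝ => Complex.exp (Complex.I * ((r : ℤ) : ℂ) * ((2 * Real.pi / T : ℝ) : ℂ) * (t : ℂ)))
      (Complex.exp (Complex.I * ((r : ℤ) : ℂ) * ((2 * Real.pi / T : ℝ) : ℂ) * (t : ℂ)) *
        (Complex.I * ((r : ℤ) : ℂ) * ((2 * Real.pi / T : ℝ) : ℂ))) t := by
    simpa using (((hasDerivAt_id (t : ℂ)).const_mul
      (Complex.I * ((r : ℤ) : ℂ) * ((2 * Real.pi / T : ℝ) : ℂ))).cexp).comp_ofReal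
  have h2 := h1.mul (hasDerivAt_matrix_exp_mul_apply (hill hT J N) (matW n N) (r, i) j t)
  refine (h2.congr_deriv ?_)
  rw [hill_mul_apply]
  set X := NormedSpace.exp ((t : ℂ) • hill hT J N) * matW n N with hX
  rw [mul_sub, Matrix.sum_apply, Finset.mul_sum]
  have : ∀ c : Idx N,
      (harmonic hT J ((r : ℤ) - (c : ℤ)) t * demodulated hT J N c t) i j =
      Complex.exp (Complex.I * ((r : ℤ) : ℂ) * ((2 * Real.pi / T : ℝ) : ℂ) * (t : ℂ)) *
        ∑ k, coeff hT J ((r : ℤ) - (c : ℤ)) i k * X (c, k) j := by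
    intro c
    rw [harmonic, demodulated, Matrix.smul_mul, Matrix.mul_smul, smul_smul, ← Complex.exp_add,
      Matrix.smul_apply, Matrix.mul_apply, smul_eq_mul]
    congr 2
    push_cast
    ring
  simp only [this]
  ring

/-- The exponential error bound. -/
lemma error_le (hJ : HasPointwiseFourierSeries hT J) (hΦ : IsFundamentalSolution J Φ) {a b : ℝ}
    (ha : 0 < a) (hs : 2 * Real.exp (-b) < 1)
    (hdecay : ∀ k : ℤ, pNorm p (coeff hT J k) ≤ a * Real.exp (-b * |(k : ℝ)|)) (N : ℕ) (t : ℝ) :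
    error p hT J Φ N t ≤ (2 * Real.exp (-b)) ^ N * (Real.exp |4 * a * t| - 1) := by
  have hA : ∀ k t, ‖lpOp p n (harmonic hT J k t)‖ ≤ a * Real.exp (-b) ^ k.natAbs := fun k t => by
    rw [norm_lpOp_harmonic, ← Real.exp_nat_mul]
    refine (hdecay k).trans_eq ?_
    rw [Nat.cast_natAbs, Int.cast_abs, mul_comm (-b)]
  have hsum : ∀ t, HasSum (fun k => lpOp p n (harmonic hT J k t))
      (lpOp p n ((J t).map (fun x : ℝ => (x : ℂ)))) := fun t => by
    have hS : Summable (fun k => lpOp p n (harmonic hT J k t)) :=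
      Summable.of_norm_bounded (hasSum_half_pow_natAbs.mul_left a).summable fun k =>
        (hA k t).trans (by gcongr; linarith)
    have h1 := hS.hasSum.comp ((Finset.tendsto_Icc_neg (R := ℤ)))
    have h2 := ((continuous_lpOp (n := n) p).tendsto _).comp (hJ t)
    -- The decay gives unconditional summability; the symmetric partial sums identify the sum as `J
    -- t`.
    have h3 := tendsto_nhds_unique (h2.congr fun K => by
      simp only [Function.comp, map_sum]; rfl) h1
    rw [h3]
    exact hS.hasSum
  have hJm : ∀ (A B : Matrix (Fin n) (Fin n) ℝ), (A * B).map (fun x : ℝ => (x : ℂ)) =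
      A.map (fun x : ℝ => (x : ℂ)) * B.map (fun x : ℝ => (x : ℂ)) := fun A B =>
    Matrix.map_mul (f := Complex.ofRealHom)
  have hφ0 : lpOp p n ((Φ 0).map (fun x : ℝ => (x : ℂ))) = 1 := by
    rw [hΦ.1, Matrix.map_one _ (by simp) (by simp), lpOp_one]
  have := norm_sub_truncated_le (R := WithLp p (Fin n → ℂ) →L[ℂ] WithLp p (Fin n → ℂ))
    ha (Real.exp_pos (-b)) hs hA hsum (φ := fun t => lpOp p n ((Φ t).map (fun x : ℝ => (x : ℂ))))
    (fun t => by
      rw [← lpOp_mul, ← hJm]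
      exact hasDerivAt_lpOp p fun i j => (hasDerivAt_matrix_apply (hΦ.2 t) i j).ofReal_comp)
    -- Only `≤ 1`: for `n = 0` the identity has norm 0.
    (by rw [hφ0]; exact ContinuousLinearMap.norm_id_le)
    (Y := fun r t => lpOp p n (demodulated hT J N r t))
    (fun r t => by
      simp only [← lpOp_mul, ← map_sum]
      exact hasDerivAt_lpOp p (hasDerivAt_demodulated hT J N r t))
    (fun r => by rw [hφ0, demodulated_zero, lpOp_one]) ⟨0, by simp⟩ t
  rw [demodulated_center, ← map_sub, norm_lpOp] at this
  simpa [error, abs_mul, abs_of_pos ha] using this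

end KoopmanHill

theorem theorem3 {n : ℕ} {T : ℝ} (hT : 0 < T)
    (J Φ : ℝ → Matrix (Fin n) (Fin n) ℝ)
    (hJper : Function.Periodic J T)
    (hJ : KoopmanHill.HasPointwiseFourierSeries hT J)
    (hΦ : KoopmanHill.IsFundamentalSolution J Φ)
    (p : ℝ≥0∞) [Fact (1 ≤ p)] (a b : ℝ) (ha : 0 < a) (hb : Real.log 2 < b)
    (hdecay : ∀ k : ℤ,
      KoopmanHill.pNorm p (KoopmanHill.coeff hT J k) ≤ a * Real.exp (-b * |(k : ℝ)|)) :
    -- the error bound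
    (∀ (N : ℕ) (t : ℝ), KoopmanHill.error p hT J Φ N t ≤
        (2 * Real.exp (-b)) ^ N * (Real.exp |4 * a * t| - 1)) ∧
    -- it decays exponentially in the truncation order, so the projection converges
    (0 < 2 * Real.exp (-b) ∧ 2 * Real.exp (-b) < 1) ∧
    (∀ t : ℝ, Tendsto (fun N : ℕ => KoopmanHill.error p hT J Φ N t) atTop (𝓝 0)) ∧
    -- sufficient truncation order; at `t = 0` the threshold is `-∞`, so that every `N` is allowed
    (∀ (t E : ℝ) (N : ℕ), 0 < E →
      (t = 0 ∨
        (|4 * a * t| + Real.log (1 - Real.exp (-|4 * a * t|)) - Real.log E) /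
          (b - Real.log 2) ≤ (N : ℝ)) →
      KoopmanHill.error p hT J Φ N t ≤ E) := by
  have hpos : 0 < 2 * Real.exp (-b) := by positivity
  have hs : 2 * Real.exp (-b) < 1 := by
    have h1 : Real.exp (-b) < Real.exp (-Real.log 2) := Real.exp_lt_exp.2 (by linarith)
    rw [Real.exp_neg (Real.log 2), Real.exp_log (by norm_num)] at h1
    linarith
  have hE := KoopmanHill.error_le p hT J Φ hJ hΦ ha hs hdecay
  refine ⟨hE, ⟨hpos, hs⟩, fun t => ?_, fun t E N hEpos h => (hE N t).trans ?_⟩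
  · refine squeeze_zero (fun N => norm_nonneg _) (fun N => hE N t) ?_
    simpa using (tendsto_pow_atTop_nhds_zero_of_lt_one hpos.le hs).mul_const
      (Real.exp |4 * a * t| - 1)
  · by_cases ht : t = 0
    · simpa [ht] using hEpos.le
    · exact KoopmanHill.pow_mul_exp_sub_one_le hb (abs_pos.2 (by positivity)) hEpos
        (h.resolve_left ht)
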